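/- Let $\Sigma$ be a finite alphabet and let $L\subseteq\Sigma^*$ be a language. Consider the eight operations on languages over $\Sigma$: $k(L)=L^*$ (Kleene star), $e(L)=L^+=LL^*$ (positive closure), $c(L)=\Sigma^*\setminus L$ (complement), $p(L)$, $f(L)$, $s(L)$, $w(L)$, the sets of all prefixes, factors (contiguous blocks), suffixes, and (scattered) subwords, respectively, of words of $L$, and $r(L)=\{x\in\Sigma^* : x^R\in L\}$ (reversal). Let $S=\{k,e,c,p,f,s,w,r\}$. For a word $x=a_1a_2\cdots a_n\in S^*$ put $x(L)=a_1(a_2(\cdots(a_n(L))\cdots))$, where the empty word acts as the identity. Then, for every $L$, the orbit $$\mathcal{O}_S(L)=\{x(L) : x\in S^*\}$$ contains at most $5676$ distinct languages. -/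

import Mathlib

open scoped Computability

/-- Names of the eight operations on languages. -/
inductive LangOp where
  /-- Kleene star -/
  | k
  /-- positive closure -/
  | e
  /-- complement -/
  | c
  /-- set of prefixes -/
  | p
  /-- set of factors -/
  | f
  /-- set of suffixes -/
  | s
  /-- set of (scattered) subwords -/
  | w
  /-- reversal -/
  | r

namespace LangOp

/-- The effect of a single operation on a language over the alphabet `α`. -/
def apply {α : Type*} : LangOp → Language α → Language α
  | k, L => L∗
  | e, L => L * L∗
  | c, L => Lᶜ
  | p, L => {x | ∃ y ∈ L, x <+: y}
  | f, L => {x | ∃ y ∈ L, x <:+: y}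
  | s, L => {x | ∃ y ∈ L, x <:+ y}
  | w, L => {x | ∃ y ∈ L, x.Sublist y}
  | r, L => {x | x.reverse ∈ L}

/-- The effect of a word `a₁ a₂ ⋯ aₙ` of operations:
`a₁ (a₂ (⋯ (aₙ L) ⋯))`; the empty word acts as the identity. -/
def applyWord {α : Type*} (x : List LangOp) (L : Language α) : Language α :=
  x.foldr apply L

/-- The orbit `{x(L) : x ∈ S*}` of `L` under the monoid generated by `S`. -/
def orbit {α : Type*} (S : Set LangOp) (L : Language α) : Set (Language α) :=
  {M | ∃ x : List LangOp, (∀ a ∈ x, a ∈ S) ∧ applyWord x L = M}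

end LangOp

/-!
The operations are studied on languages *up to the empty word*, and up to collapsing the trivial
languages `∅`, `{ε}`, `Σ⁺`, `Σ*`, which no operation leaves. Write `M ⊑ N` (`LangOp.Red`) if `M` is
trivial or has the same nonempty words as `N`. Every operation preserves `⊑`
(`LangOp.Red.congr_apply`), so each rule `u ⊑ v`, meaning `u(L) ⊑ v(L)` for all `L`, may be applied
inside longer words. Up to the empty word `e` is the same as `k`, and `r` can be moved to the right
end of a word at the price of exchanging `p` and `s` (`LangOp.apply_r_apply`). Hence every language
in the orbit compares with `v(L)` or `v(Lᴿ)` for a word `v` over `k`, `c`, `p`, `s`, `f`, `w`.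

The rules used all shorten words, so only irreducible words `v` are needed, and there are 1062 of
them (`LangOp.irreducibles_check`). A language is determined by its set of nonempty words and by
whether it contains the empty word, which bounds the orbit by `2 * (2 + 2 * 1062) = 4252`.

Besides the evident relations between the closure operators, the rules come from these facts.
* Star preserves closedness under `p`, `s`, `f`, `w` (`LangOp.apply_block_k_block`), and `w`
  commutes with star.
* Kuratowski's identity `xcxcxcx = xcx` for the closure operators `x = k`, `p`, `kp`.
* The complement of a prefix-closed language is a right ideal. Thus its suffixes are everything or
  nothing (`LangOp.isTrivial_apply_s_c_p`), and star adds at most the empty word to it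
  (`LangOp.red_apply_k_c_p`).
* `pcpck ⊑ pk` and `pcpcpk ⊑ pk` (`LangOp.red_apply_p_c_p_c`): the largest right ideal inside `L*`,
  or inside the prefix closure of `L*`, absorbs `L*` from the left, so once it is nonempty its
  prefixes are all the prefixes of `L*`.
-/

namespace LangOp

variable {α : Type*}

/-! ### Languages up to the empty word and up to triviality -/

/-- `M` contains either no nonempty word or all nonempty words: it is one of `∅`, `{ε}`, `Σ⁺`,
`Σ*`, a family which is stable under all eight operations. -/
def IsTrivial (M : Language α) : Prop :=
  (∀ x ∈ M, x = []) ∨ ∀ x ≠ [], x ∈ M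

/-- `M` is trivial, or has the same nonempty words as `N`. This is transitive but, because of the
first alternative, not symmetric. -/
def Red (M N : Language α) : Prop :=
  IsTrivial M ∨ ∀ x ≠ [], x ∈ M ↔ x ∈ N

theorem Red.refl (M : Language α) : Red M M := Or.inr fun _ _ => Iff.rfl

theorem Red.of_eq {M N : Language α} (h : M = N) : Red M N := h ▸ Red.refl M

theorem IsTrivial.red {M : Language α} (h : IsTrivial M) (N : Language α) : Red M N := Or.inl h

theorem Red.isTrivial {M N : Language α} (h : Red M N) (hN : IsTrivial N) : IsTrivial M := by
  rcases h with h | h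
  · exact h
  · refine hN.imp (fun hN x hx => ?_) fun hN x hx => (h x hx).2 (hN x hx)
    by_contra hne
    exact hne (hN x ((h x hne).1 hx))

theorem Red.trans {M N K : Language α} (h : Red M N) (h' : Red N K) : Red M K := by
  rcases h' with h' | h'
  · exact (h.isTrivial h').red K
  · exact h.imp_right fun h x hx => (h x hx).trans (h' x hx)

/-! ### The single operations -/

/-- Equality is decided on constructor indices, which the kernel compares quickly. -/
instance : DecidableEq LangOp := fun a b =>
  decidable_of_iff (a.ctorIdx = b.ctorIdx)
    ⟨fun h => by cases a <;> cases b <;> first | rfl | exact absurd h (by decide),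
      fun h => h ▸ rfl⟩

/-- The order on words under which `p`, `s`, `f` and `w` form lower closures. -/
def blockRel : LangOp → List α → List α → Prop
  | p => (· <+: ·)
  | s => (· <:+ ·)
  | f => (· <:+: ·)
  | w => List.Sublist
  | _ => (· = ·)

/-- The operations which form the lower closure of a language under an order on words. -/
def blockOps : List LangOp := [p, s, f, w]

theorem mem_apply_block {a : LangOp} (ha : a ∈ blockOps) {L : Language α} {x : List α} :
    x ∈ apply a L ↔ ∃ y ∈ L, blockRel a x y := by
  simp only [blockOps, List.mem_cons, List.not_mem_nil, or_false] at ha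
  rcases ha with rfl | rfl | rfl | rfl <;> rfl

theorem blockRel_refl (a : LangOp) (x : List α) : blockRel a x x := by
  cases a <;> simp [blockRel]

theorem blockRel_trans {a : LangOp} {x y z : List α} (h : blockRel a x y) (h' : blockRel a y z) :
    blockRel a x z := by
  cases a
  case p => exact List.IsPrefix.trans h h'
  case s => exact List.IsSuffix.trans h h'
  case f => exact List.IsInfix.trans h h'
  case w => exact List.Sublist.trans h h'
  all_goals exact Eq.trans h h'

theorem eq_nil_of_blockRel_nil {a : LangOp} {x : List α} (h : blockRel a x []) : x = [] := by
  cases a <;> simpa [blockRel] using h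

theorem mem_apply_c {L : Language α} {x : List α} : x ∈ apply c L ↔ x ∉ L := Iff.rfl

theorem mem_apply_p {L : Language α} {x : List α} : x ∈ apply p L ↔ ∃ y, x ++ y ∈ L := by
  constructor
  · rintro ⟨_, h, y, rfl⟩
    exact ⟨y, h⟩
  · rintro ⟨y, h⟩
    exact ⟨_, h, y, rfl⟩

theorem apply_c_c (L : Language α) : apply c (apply c L) = L := compl_compl (α := Set (List α)) L

theorem apply_r_r (L : Language α) : apply r (apply r L) = L := L.reverse_reverse

/-- The operations among the eight that are closure operators, except `e`. -/
def closureOps : List LangOp := k :: blockOps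

theorem apply_mono {a : LangOp} (ha : a ∈ closureOps) : Monotone (apply a (α := α)) := by
  intro L M h
  rcases List.mem_cons.1 ha with rfl | ha
  · exact kstar_mono h
  · intro x hx
    obtain ⟨y, hy, hxy⟩ := (mem_apply_block ha).1 hx
    exact (mem_apply_block ha).2 ⟨y, h hy, hxy⟩

theorem le_apply {a : LangOp} (ha : a ∈ closureOps) (L : Language α) : L ≤ apply a L := by
  rcases List.mem_cons.1 ha with rfl | ha
  · exact le_kstar
  · exact fun x hx => (mem_apply_block ha).2 ⟨x, hx, blockRel_refl a x⟩

theorem apply_idem {a : LangOp} (ha : a ∈ closureOps) (L : Language α) :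
    apply a (apply a L) = apply a L := by
  rcases List.mem_cons.1 ha with rfl | hb
  · exact kstar_idem L
  · refine le_antisymm (fun x hx => ?_) (le_apply ha _)
    obtain ⟨y, hy, hxy⟩ := (mem_apply_block hb).1 hx
    obtain ⟨z, hz, hyz⟩ := (mem_apply_block hb).1 hy
    exact (mem_apply_block hb).2 ⟨z, hz, blockRel_trans hxy hyz⟩

/-- The symmetry of the operations induced by reversal. -/
def mirror : LangOp → LangOp
  | p => s
  | s => p
  | a => a

theorem apply_r_apply (a : LangOp) (L : Language α) :
    apply r (apply a L) = apply (mirror a) (apply r L) := by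
  have hmem : ∀ (M : Language α) x, x ∈ apply r M ↔ x.reverse ∈ M := fun _ _ => Iff.rfl
  have hblock : ∀ a ∈ blockOps, mirror a ∈ blockOps →
      (∀ x y : List α, blockRel a x.reverse y.reverse ↔ blockRel (mirror a) x y) →
      apply r (apply a L) = apply (mirror a) (apply r L) := by
    intro a ha ha' h
    ext x
    rw [hmem, mem_apply_block ha, mem_apply_block ha']
    constructor
    · rintro ⟨y, hy, hxy⟩
      refine ⟨y.reverse, by rwa [hmem, List.reverse_reverse], (h _ _).1 ?_⟩
      rwa [List.reverse_reverse]
    · rintro ⟨y, hy, hxy⟩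
      exact ⟨y.reverse, hy, (h _ _).2 hxy⟩
  cases a
  case k => exact Language.reverse_kstar L
  case e =>
    change (L * L∗).reverse = L.reverse * L.reverse∗
    rw [← Language.mul_self_kstar_comm, Language.reverse_mul, Language.reverse_kstar]
  case c => rfl
  case r => rfl
  case p => exact hblock p (by decide) (by decide) fun _ _ => List.reverse_prefix
  case s => exact hblock s (by decide) (by decide) fun _ _ => List.reverse_suffix
  case f => exact hblock f (by decide) (by decide) fun _ _ => List.reverse_infix
  case w => exact hblock w (by decide) (by decide) fun _ _ => List.reverse_sublist

/-! ### The operations respect the comparison -/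

theorem apply_le_one {a : LangOp} (ha : a ∈ closureOps) {L : Language α} (h : L ≤ 1) :
    apply a L ≤ 1 := by
  rcases List.mem_cons.1 ha with rfl | ha
  · exact (kstar_mono h).trans (kstar_one (α := Language α)).le
  · intro x hx
    obtain ⟨y, hy, hxy⟩ := (mem_apply_block ha).1 hx
    obtain rfl : y = [] := h hy
    exact eq_nil_of_blockRel_nil hxy

theorem mem_apply_of_agree {a : LangOp} (ha : a ∈ closureOps) {M N : Language α}
    (h : ∀ x ≠ [], x ∈ M → x ∈ N) {x : List α} (hne : x ≠ []) (hx : x ∈ apply a M) :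
    x ∈ apply a N := by
  rcases List.mem_cons.1 ha with rfl | ha
  · obtain ⟨S, rfl, hS⟩ := Language.mem_kstar_iff_exists_nonempty.1 hx
    exact Language.join_mem_kstar fun y hy => h y (hS y hy).2 (hS y hy).1
  · obtain ⟨y, hy, hxy⟩ := (mem_apply_block ha).1 hx
    refine (mem_apply_block ha).2 ⟨y, h y ?_ hy, hxy⟩
    rintro rfl
    exact hne (eq_nil_of_blockRel_nil hxy)

theorem mem_apply_e_iff {L : Language α} {x : List α} (hx : x ≠ []) :
    x ∈ apply e L ↔ x ∈ apply k L := by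
  have h : apply k L = 1 + apply e L := (Language.one_add_self_mul_kstar_eq_kstar L).symm
  rw [h, Language.mem_add, Language.mem_one, or_iff_right hx]

/-- Up to the empty word, positive closure and Kleene star are the same. -/
theorem red_apply_e (L : Language α) : Red (apply e L) (apply k L) :=
  Or.inr fun _ hx => mem_apply_e_iff hx

theorem isTrivial_apply (a : LangOp) {M : Language α} (h : IsTrivial M) :
    IsTrivial (apply a M) := by
  have hcl : ∀ a ∈ closureOps, IsTrivial (apply a M) := fun a ha =>
    h.imp (fun h => apply_le_one ha (L := M) h) fun h x hx => le_apply ha M (h x hx)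
  cases a
  case e => exact (red_apply_e M).isTrivial (hcl k (by decide))
  case c =>
    rcases h with h | h
    · exact Or.inr fun x hx hxM => hx (h x hxM)
    · exact Or.inl fun x hxM => by_contra fun hx => hxM (h x hx)
  case r =>
    exact h.imp (fun h x hx => by simpa using h _ hx)
      fun h x hx => h _ (by simpa using hx)
  all_goals exact hcl _ (by decide)

theorem Red.congr_apply (a : LangOp) {M N : Language α} (h : Red M N) :
    Red (apply a M) (apply a N) := by
  refine h.imp (isTrivial_apply a) fun h x hx => ?_
  have hcl : ∀ a ∈ closureOps, x ∈ apply a M ↔ x ∈ apply a N := fun a ha =>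
    ⟨mem_apply_of_agree ha (fun x hx => (h x hx).1) hx,
      mem_apply_of_agree ha (fun x hx => (h x hx).2) hx⟩
  cases a
  case e => rw [mem_apply_e_iff hx, mem_apply_e_iff hx, hcl k (by decide)]
  case c => exact not_congr (h x hx)
  case r => exact h _ (by simpa using hx)
  all_goals exact hcl _ (by decide)

/-! ### Exact identities between the closure operators -/

/-- Pairs `(a, b)` of block operations such that the order defining `a` is contained in the order
defining `b`. -/
def absorbing : List (LangOp × LangOp) :=
  [(p, p), (p, f), (p, w), (s, s), (s, f), (s, w), (f, f), (f, w), (w, w)]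

theorem mem_blockOps_of_mem_absorbing {a b : LangOp} (h : (a, b) ∈ absorbing) :
    a ∈ blockOps ∧ b ∈ blockOps := by
  have : ∀ q ∈ absorbing, q.1 ∈ blockOps ∧ q.2 ∈ blockOps := by decide
  exact this _ h

theorem mem_closureOps_of_mem_absorbing {a b : LangOp} (h : (a, b) ∈ absorbing) :
    a ∈ closureOps ∧ b ∈ closureOps :=
  ⟨List.mem_cons_of_mem _ (mem_blockOps_of_mem_absorbing h).1,
    List.mem_cons_of_mem _ (mem_blockOps_of_mem_absorbing h).2⟩

theorem blockRel_of_mem_absorbing {a b : LangOp} (h : (a, b) ∈ absorbing) {x y : List α}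
    (hxy : blockRel a x y) : blockRel b x y := by
  simp only [absorbing, List.mem_cons, Prod.mk.injEq, List.not_mem_nil, or_false] at h
  rcases h with ⟨rfl, rfl⟩ | ⟨rfl, rfl⟩ | ⟨rfl, rfl⟩ | ⟨rfl, rfl⟩ | ⟨rfl, rfl⟩ | ⟨rfl, rfl⟩ |
    ⟨rfl, rfl⟩ | ⟨rfl, rfl⟩ | ⟨rfl, rfl⟩
  · exact hxy
  · exact List.IsPrefix.isInfix hxy
  · exact List.IsPrefix.sublist hxy
  · exact hxy
  · exact List.IsSuffix.isInfix hxy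
  · exact List.IsSuffix.sublist hxy
  · exact hxy
  · exact List.IsInfix.sublist hxy
  · exact hxy

theorem apply_absorb_left {a b : LangOp} (h : (a, b) ∈ absorbing) (L : Language α) :
    apply a (apply b L) = apply b L := by
  obtain ⟨ha, hb⟩ := mem_blockOps_of_mem_absorbing h
  refine le_antisymm (fun x hx => ?_) (le_apply (mem_closureOps_of_mem_absorbing h).1 _)
  obtain ⟨y, hy, hxy⟩ := (mem_apply_block ha).1 hx
  obtain ⟨z, hz, hyz⟩ := (mem_apply_block hb).1 hy
  exact (mem_apply_block hb).2 ⟨z, hz, blockRel_trans (blockRel_of_mem_absorbing h hxy) hyz⟩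

theorem apply_absorb_right {a b : LangOp} (h : (a, b) ∈ absorbing) (L : Language α) :
    apply b (apply a L) = apply b L := by
  obtain ⟨ha, hb⟩ := mem_blockOps_of_mem_absorbing h
  obtain ⟨ha', hb'⟩ := mem_closureOps_of_mem_absorbing h
  refine le_antisymm (fun x hx => ?_) (apply_mono hb' (le_apply ha' L))
  obtain ⟨y, hy, hxy⟩ := (mem_apply_block hb).1 hx
  obtain ⟨z, hz, hyz⟩ := (mem_apply_block ha).1 hy
  exact (mem_apply_block hb).2 ⟨z, hz, blockRel_trans hxy (blockRel_of_mem_absorbing h hyz)⟩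

theorem apply_p_s (L : Language α) : apply p (apply s L) = apply f L := by
  ext x
  rw [mem_apply_p]
  constructor
  · rintro ⟨y, z, hz, t, rfl⟩
    exact ⟨_, hz, t, y, by simp⟩
  · rintro ⟨_, hz, t, y, rfl⟩
    exact ⟨y, _, hz, t, by simp⟩

theorem apply_s_p (L : Language α) : apply s (apply p L) = apply f L := by
  have h := apply_r_apply f (apply r L)
  rw [← apply_p_s, apply_r_apply, apply_r_apply, apply_r_r] at h
  exact h

theorem append_mem_apply_k {L : Language α} {x y : List α} (hx : x ∈ apply k L)
    (hy : y ∈ apply k L) : x ++ y ∈ apply k L := by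
  obtain ⟨S, rfl, hS⟩ := hx
  obtain ⟨T, rfl, hT⟩ := hy
  refine ⟨S ++ T, by simp, fun z hz => ?_⟩
  exact (List.mem_append.1 hz).elim (hS z) (hT z)

/-- The star of a prefix-closed language is prefix-closed. -/
theorem apply_p_k_p (L : Language α) :
    apply p (apply k (apply p L)) = apply k (apply p L) := by
  refine le_antisymm ?_ (le_apply (by decide) _)
  rintro x ⟨_, ⟨S, rfl, hS⟩, hx⟩
  induction S generalizing x with
  | nil =>
    obtain rfl : x = [] := by simpa using hx
    exact Language.nil_mem_kstar _
  | cons y S ih =>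
    rw [List.forall_mem_cons] at hS
    rw [List.flatten_cons] at hx
    rcases List.prefix_or_prefix_of_prefix hx (List.prefix_append y S.flatten) with h | ⟨z, rfl⟩
    · refine le_apply (a := k) (by decide) (apply p L) ?_
      rw [← apply_idem (a := p) (by decide)]
      exact ⟨y, hS.1, h⟩
    · have hz := ih hS.2 ((List.prefix_append_right_inj y).1 hx)
      exact append_mem_apply_k (le_apply (a := k) (by decide) _ hS.1) hz

theorem apply_s_k_s (L : Language α) :
    apply s (apply k (apply s L)) = apply k (apply s L) := by
  have h := congrArg (apply r) (apply_p_k_p (apply r L))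
  simpa only [apply_r_apply p, apply_r_apply k, apply_r_apply c, mirror, apply_r_r] using h

/-- Taking scattered subwords commutes with the Kleene star. -/
theorem apply_w_k (L : Language α) : apply w (apply k L) = apply k (apply w L) := by
  refine le_antisymm ?_ ?_
  · rintro x ⟨_, ⟨S, rfl, hS⟩, hx⟩
    induction S generalizing x with
    | nil =>
      obtain rfl : x = [] := by simpa using hx
      exact Language.nil_mem_kstar _
    | cons y S ih =>
      rw [List.forall_mem_cons] at hS
      obtain ⟨u, v, rfl, hu, hv⟩ := List.sublist_append_iff.1 (List.flatten_cons ▸ hx)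
      obtain ⟨T, rfl, hT⟩ := ih hS.2 hv
      exact ⟨u :: T, rfl, List.forall_mem_cons.2 ⟨⟨y, hS.1, hu⟩, hT⟩⟩
  · rintro _ ⟨S, rfl, hS⟩
    induction S with
    | nil => exact ⟨[], Language.nil_mem_kstar _, List.Sublist.refl _⟩
    | cons u S ih =>
      rw [List.forall_mem_cons] at hS
      obtain ⟨y, hy, hu⟩ := hS.1
      obtain ⟨_, ⟨T, rfl, hT⟩, hv⟩ := ih hS.2
      exact ⟨(y :: T).flatten, ⟨y :: T, rfl, List.forall_mem_cons.2 ⟨hy, hT⟩⟩, hu.append hv⟩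

/-- The star of a language closed under a block operation is closed under it. -/
theorem apply_block_k_block {a : LangOp} (ha : a ∈ blockOps) (L : Language α) :
    apply a (apply k (apply a L)) = apply k (apply a L) := by
  simp only [blockOps, List.mem_cons, List.not_mem_nil, or_false] at ha
  rcases ha with rfl | rfl | rfl | rfl
  · exact apply_p_k_p L
  · exact apply_s_k_s L
  · have hs : apply s (apply k (apply f L)) = apply k (apply f L) := by
      rw [← apply_s_p, apply_s_k_s]
    have hp : apply p (apply k (apply f L)) = apply k (apply f L) := by
      rw [← apply_p_s, apply_p_k_p]
    rw [← apply_p_s, hs, hp]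
  · rw [apply_w_k, apply_idem (by decide)]

theorem apply_absorb_k {a b : LangOp} (h : (a, b) ∈ absorbing) (L : Language α) :
    apply a (apply k (apply b L)) = apply k (apply b L) := by
  rw [← apply_block_k_block (mem_blockOps_of_mem_absorbing h).2, apply_absorb_left h]

theorem apply_k_block_k {a : LangOp} (ha : a ∈ blockOps) (L : Language α) :
    apply k (apply a (apply k L)) = apply k (apply a L) := by
  have ha' : a ∈ closureOps := List.mem_cons_of_mem _ ha
  have hk : k ∈ closureOps := by decide
  refine le_antisymm ?_ (apply_mono hk (apply_mono ha' (le_apply hk L)))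
  calc apply k (apply a (apply k L))
      ≤ apply k (apply a (apply k (apply a L))) :=
        apply_mono hk (apply_mono ha' (apply_mono hk (le_apply ha' L)))
    _ = apply k (apply a L) := by rw [apply_block_k_block ha, apply_idem hk]

theorem apply_s_k_p (L : Language α) :
    apply s (apply k (apply p L)) = apply f (apply k (apply p L)) := by
  rw [← apply_s_p, apply_p_k_p]

/-- Kuratowski's identity. -/
theorem kuratowski {β : Type*} [BooleanAlgebra β] (F : ClosureOperator β) (b : β) :
    F (F (F (F b)ᶜ)ᶜ)ᶜ = F (F b)ᶜ := by
  apply le_antisymm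
  · calc F (F (F (F b)ᶜ)ᶜ)ᶜ ≤ F (F (F b)ᶜ) :=
          F.monotone (compl_le_iff_compl_le.1 (F.le_closure _))
      _ = F (F b)ᶜ := F.idempotent _
  · refine F.monotone (compl_le_compl ?_)
    calc F (F (F b)ᶜ)ᶜ ≤ F (F b) := F.monotone (compl_le_iff_compl_le.1 (F.le_closure _))
      _ = F b := F.idempotent b

/-- The Kleene star of the prefix closure, as a closure operator: the least prefix-closed
submonoid above a language. -/
def kstarPrefixClosure : ClosureOperator (Language α) :=
  ClosureOperator.mk' (fun L => apply k (apply p L))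
    ((apply_mono (by decide)).comp (apply_mono (by decide)))
    (fun L => (le_apply (by decide) L).trans (le_apply (by decide) _))
    (fun L => by rw [apply_p_k_p, apply_idem (by decide)])

theorem apply_kuratowski {a : LangOp} (ha : a ∈ closureOps) (L : Language α) :
    applyWord [a, c, a, c, a, c, a] L = applyWord [a, c, a] L :=
  kuratowski (ClosureOperator.mk' (apply a) (apply_mono ha) (le_apply ha)
    fun L => (apply_idem ha L).le) L

/-! ### Complements of closed languages -/

/-- A right ideal which contains a word `v` contains every `v ++ u`, so all words are suffixes. -/
theorem isTrivial_apply_s_c_p (L : Language α) : IsTrivial (apply s (apply c (apply p L))) := by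
  by_cases h : ∃ v, v ∉ apply p L
  · obtain ⟨v, hv⟩ := h
    refine Or.inr fun u _ => ⟨v ++ u, fun huv => hv ?_, List.suffix_append v u⟩
    rw [← apply_idem (by decide)]
    exact ⟨_, huv, List.prefix_append v u⟩
  · push Not at h
    exact Or.inl fun u ⟨v, hv, _⟩ => (hv (h v)).elim

/-- A right ideal is a subsemigroup, so its star adds at most the empty word. -/
theorem red_apply_k_c_p (L : Language α) :
    Red (apply k (apply c (apply p L))) (apply c (apply p L)) := by
  refine Or.inr fun x hx => ⟨fun h => ?_, fun h => le_apply (by decide) _ h⟩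
  obtain ⟨S, rfl, hS⟩ := Language.mem_kstar_iff_exists_nonempty.1 h
  cases S with
  | nil => exact (hx rfl).elim
  | cons y S =>
    rw [List.forall_mem_cons] at hS
    refine fun hp => hS.1.1 ?_
    rw [← apply_idem (by decide)]
    exact ⟨_, hp, List.prefix_append _ _⟩

theorem red_apply_k_c_s (L : Language α) :
    Red (apply k (apply c (apply s L))) (apply c (apply s L)) := by
  have h := (red_apply_k_c_p (apply r L)).congr_apply r
  simpa only [apply_r_apply p, apply_r_apply k, apply_r_apply c, mirror, apply_r_r] using h

theorem red_apply_k_c_block {a : LangOp} (ha : a ∈ blockOps) (L : Language α) :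
    Red (apply k (apply c (apply a L))) (apply c (apply a L)) := by
  by_cases h : (p, a) ∈ absorbing
  · rw [← apply_absorb_left h]
    exact red_apply_k_c_p _
  · obtain rfl : a = s := by
      revert a
      decide
    exact red_apply_k_c_s L

/-- Let `K` act on `M` from the left, with `M` contained in the prefixes of `K`. The language
`c p c M` is the largest right ideal contained in `M`, and it is again stable under `K`; hence, if
it has an element `j`, then its prefixes include those of the words `x ++ j` with `x ∈ K`, that is,
all prefixes of `K`. -/
theorem red_apply_p_c_p_c {K M : Language α} (hKM : ∀ x ∈ K, ∀ y ∈ M, x ++ y ∈ M)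
    (hM : M ≤ apply p K) : Red (apply p (apply c (apply p (apply c M)))) (apply p K) := by
  have hp : p ∈ closureOps := by decide
  have hmem : ∀ {j}, j ∈ apply c (apply p (apply c M)) ↔ ∀ y, j ++ y ∈ M := by
    intro j
    rw [mem_apply_c, mem_apply_p, not_exists]
    exact forall_congr' fun y => not_not
  by_cases h : ∃ j, j ∈ apply c (apply p (apply c M))
  · obtain ⟨j, hj⟩ := h
    refine Red.of_eq (le_antisymm ?_ ?_) <;> rw [← apply_idem hp K]
    · refine apply_mono hp (le_trans (fun x hx => ?_) hM)
      have := hmem.1 hx []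
      rwa [List.append_nil] at this
    · rw [apply_idem hp, ← apply_idem hp (apply c _)]
      refine apply_mono hp fun x hx => mem_apply_p.2 ⟨j, hmem.2 fun y => ?_⟩
      rw [List.append_assoc]
      exact hKM x hx _ (hmem.1 hj y)
  · refine IsTrivial.red (Or.inl fun x hx => ?_) _
    obtain ⟨y, hy⟩ := mem_apply_p.1 hx
    exact (h ⟨_, hy⟩).elim

/-! ### Length-decreasing rewriting rules -/

/-- The rules `u → v`, up to exchanging prefixes and suffixes. If `u(L)` is trivial for all `L`,
the right-hand side is the empty word. -/
def baseRules : List (List LangOp × List LangOp) :=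
  [([c, c], []), ([p, s], [f]), ([w, k, p], [k, w]), ([w, k, f], [k, w]),
    ([s, c, s, k, p], []),
    ([p, c, p, c, k], [p, k]), ([p, c, p, c, p, k], [p, k]),
    ([k, c, k, c, k, c, k], [k, c, k]), ([p, c, p, c, p, c, p], [p, c, p]),
    ([k, p, c, k, p, c, k, p, c, k, p], [k, p, c, k, p])] ++
  [k, p, f, w].map (fun a => ([a, a], [a])) ++
  [(p, f), (p, w), (f, w)].flatMap (fun q =>
    [([q.1, q.2], [q.2]), ([q.2, q.1], [q.2]), ([q.1, k, q.2], [k, q.2])]) ++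
  [p, f, w].flatMap (fun a =>
    [([a, k, a], [k, a]), ([k, a, k], [k, a]), ([k, c, a], [c, a]), ([k, c, k, a], [c, k, a])]) ++
  [s, f, w].flatMap (fun a => [p, f, w].flatMap (fun b =>
    [([a, c, b], []), ([a, c, k, b], [])]))

/-- The rules of `baseRules` and their mirror images. -/
def rules : List (List LangOp × List LangOp) :=
  baseRules ++ baseRules.map (fun q => (q.1.map mirror, q.2.map mirror))

variable (α) in
/-- Rewriting `u` to `v` is sound: `u(L)` is trivial or agrees with `v(L)` up to the empty word. -/
def Reduces (u v : List LangOp) : Prop :=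
  ∀ L : Language α, Red (applyWord u L) (applyWord v L)

theorem Reduces.refl (u : List LangOp) : Reduces α u u := fun _ => Red.refl _

theorem Reduces.trans {u v x : List LangOp} (h : Reduces α u v) (h' : Reduces α v x) :
    Reduces α u x := fun L => (h L).trans (h' L)

theorem Reduces.cons {u v : List LangOp} (a : LangOp) (h : Reduces α u v) :
    Reduces α (a :: u) (a :: v) := fun L => (h L).congr_apply a

theorem Reduces.append_right {u v : List LangOp} (h : Reduces α u v) (x : List LangOp) :
    Reduces α (u ++ x) (v ++ x) := fun L => by
  simpa only [applyWord, List.foldr_append] using h (applyWord x L)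

theorem apply_r_applyWord (u : List LangOp) (L : Language α) :
    apply r (applyWord u L) = applyWord (u.map mirror) (apply r L) := by
  induction u with
  | nil => rfl
  | cons a u ih =>
    change apply r (apply a (applyWord u L)) = _
    rw [apply_r_apply, ih]
    rfl

theorem Reduces.map_mirror {u v : List LangOp} (h : Reduces α u v) :
    Reduces α (u.map mirror) (v.map mirror) := fun L => by
  have := (h (apply r L)).congr_apply r
  rwa [apply_r_applyWord, apply_r_applyWord, apply_r_r] at this

theorem isTrivial_apply_c_block {a b : LangOp} (ha : a ∈ [s, f, w]) (hb : b ∈ [p, f, w])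
    {L : Language α} (hL : apply b L = L) : IsTrivial (apply a (apply c L)) := by
  have ha' : (s, a) ∈ absorbing := by revert a; decide
  have hb' : (p, b) ∈ absorbing := by clear hL; revert b; decide
  rw [← apply_absorb_right ha', ← hL, ← apply_absorb_left hb']
  exact isTrivial_apply a (isTrivial_apply_s_c_p _)

theorem reduces_of_mem_baseRules :
    ∀ q ∈ baseRules, Reduces α q.1 q.2 := by
  simp only [baseRules, List.forall_mem_append, and_assoc]
  refine ⟨?_, ?_, ?_, ?_, ?_⟩
  · simp only [List.forall_mem_cons, List.not_mem_nil, false_imp_iff, implies_true, and_true]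
    refine ⟨fun L => .of_eq (apply_c_c L), fun L => .of_eq (apply_p_s L), fun L => .of_eq ?_,
      fun L => .of_eq ?_, fun L => .inl ?_, fun L => ?_, fun L => ?_,
      fun L => .of_eq (apply_kuratowski (by decide) L),
      fun L => .of_eq (apply_kuratowski (by decide) L),
      fun L => .of_eq (kuratowski kstarPrefixClosure L)⟩
    · change apply w (apply k (apply p L)) = apply k (apply w L)
      rw [apply_w_k, apply_absorb_right (a := p) (b := w) (by decide)]
    · change apply w (apply k (apply f L)) = apply k (apply w L)
      rw [apply_w_k, apply_absorb_right (a := f) (b := w) (by decide)]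
    · change IsTrivial (apply s (apply c (apply s (apply k (apply p L)))))
      rw [apply_s_k_p]
      exact isTrivial_apply_c_block (b := f) (by decide) (by decide) (apply_idem (by decide) _)
    · exact red_apply_p_c_p_c (fun _ hx _ hy => append_mem_apply_k hx hy)
        (le_apply (by decide) (apply k L))
    · refine red_apply_p_c_p_c (K := apply k L) (fun x hx y hy => ?_) le_rfl
      obtain ⟨z, hz⟩ := mem_apply_p.1 hy
      refine mem_apply_p.2 ⟨z, ?_⟩
      rw [List.append_assoc]
      exact append_mem_apply_k hx hz
  · simp only [List.forall_mem_map]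
    exact fun a ha L => .of_eq (apply_idem (by revert a; decide) L)
  · rw [List.forall_mem_flatMap]
    have hq : ∀ q ∈ [(p, f), (p, w), (f, w)], q ∈ absorbing := by decide
    intro q h
    simp only [List.forall_mem_cons, List.not_mem_nil, false_imp_iff, implies_true, and_true]
    exact ⟨fun L => .of_eq (apply_absorb_left (hq q h) L),
      fun L => .of_eq (apply_absorb_right (hq q h) L),
      fun L => .of_eq (apply_absorb_k (hq q h) L)⟩
  · rw [List.forall_mem_flatMap]
    intro a h
    simp only [List.forall_mem_cons, List.not_mem_nil, false_imp_iff, implies_true, and_true]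
    have ha : a ∈ blockOps := by revert a; decide
    refine ⟨fun L => .of_eq (apply_block_k_block ha L), fun L => .of_eq (apply_k_block_k ha L),
      red_apply_k_c_block ha, fun L => ?_⟩
    have := red_apply_k_c_block ha (apply k (apply a L))
    rwa [apply_block_k_block ha] at this
  · rw [List.forall_mem_flatMap]
    intro a ha
    rw [List.forall_mem_flatMap]
    intro b hb
    simp only [List.forall_mem_cons, List.not_mem_nil, false_imp_iff, implies_true, and_true]
    have hb' : b ∈ blockOps := by revert b; decide
    exact ⟨fun L => .inl (isTrivial_apply_c_block ha hb
        (apply_idem (List.mem_cons_of_mem _ hb') L)),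
      fun L => .inl (isTrivial_apply_c_block ha hb (apply_block_k_block hb' L))⟩

theorem reduces_of_mem_rules {q : List LangOp × List LangOp} (hq : q ∈ rules) :
    Reduces α q.1 q.2 := by
  rcases List.mem_append.1 hq with hq | hq
  · exact reduces_of_mem_baseRules q hq
  · obtain ⟨q', hq', rfl⟩ := List.mem_map.1 hq
    exact (reduces_of_mem_baseRules q' hq').map_mirror

/-! ### Irreducible words -/

/-- The operations that occur in irreducible words; `e` agrees with `k` up to the empty word, and
`r` is moved to the right end of a word. -/
def letters : List LangOp := [k, c, p, s, f, w]

/-- The rules whose left-hand side begins with `a`. -/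
def rulesFor (a : LangOp) : List (List LangOp × List LangOp) :=
  rules.filter fun q => [a].isPrefixOf q.1

/-- Whether a rule applies to a word at its left end. -/
def reducible : List LangOp → Bool
  | [] => false
  | a :: v => (rulesFor a).any fun q => q.1.isPrefixOf (a :: v)

/-- The words obtained from `v` by prepending successively at most `n` letters in such a way that
no rule applies at the left end. -/
def irreducibles : ℕ → List LangOp → List (List LangOp)
  | 0, v => [v]
  | n + 1, v => v :: letters.flatMap fun a =>
      if reducible (a :: v) then [] else irreducibles n (a :: v)

/-- The tree of irreducible words, explored by the kernel: it has 1062 nodes, and the bound 20 on its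
depth is not reached. -/
theorem irreducibles_check :
    (irreducibles 20 []).length ≤ 1062 ∧ ∀ v ∈ irreducibles 20 [], v.length < 20 := by
  decide +kernel

theorem self_mem_irreducibles (n : ℕ) (v : List LangOp) : v ∈ irreducibles n v := by
  cases n <;> simp [irreducibles]

theorem cons_mem_irreducibles {a : LangOp} (ha : a ∈ letters) {n : ℕ} {u v : List LangOp}
    (hv : v ∈ irreducibles n u) (hlen : v.length < u.length + n)
    (hred : reducible (a :: v) = false) : a :: v ∈ irreducibles n u := by
  induction n generalizing u with
  | zero =>
    obtain rfl : v = u := by simpa [irreducibles] using hv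
    exact (lt_irrefl _ hlen).elim
  | succ n ih =>
    refine List.mem_cons_of_mem _ (List.mem_flatMap.2 ?_)
    rcases List.mem_cons.1 hv with rfl | hv
    · exact ⟨a, ha, by simpa [hred] using self_mem_irreducibles n _⟩
    · obtain ⟨b, hb, hv⟩ := List.mem_flatMap.1 hv
      refine ⟨b, hb, ?_⟩
      split_ifs at hv ⊢
      · simp at hv
      · exact ih hv (by simp only [List.length_cons]; omega)

theorem exists_rule_of_reducible {v : List LangOp} (h : reducible v = true) :
    ∃ q ∈ rules, ∃ t, v = q.1 ++ t := by
  cases v with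
  | nil => simp [reducible] at h
  | cons a v =>
    obtain ⟨q, hq, hpre⟩ := List.any_eq_true.1 h
    obtain ⟨t, ht⟩ := List.isPrefixOf_iff_prefix.1 hpre
    exact ⟨q, (List.mem_filter.1 hq).1, t, ht.symm⟩

theorem rules_wellFormed :
    ∀ q ∈ rules, q.2.length < q.1.length ∧ ∀ a ∈ q.2, a ∈ letters := by
  decide +kernel

variable (α) in
/-- Every word over `letters` reduces to an irreducible one. -/
theorem exists_irreducible (x : List LangOp) (hx : ∀ a ∈ x, a ∈ letters) :
    ∃ v ∈ irreducibles 20 [], (∀ a ∈ v, a ∈ letters) ∧ v.length ≤ x.length ∧ Reduces α x v := by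
  induction hn : x.length using Nat.strong_induction_on generalizing x with
  | _ n ih =>
    subst hn
    cases x with
    | nil => exact ⟨[], self_mem_irreducibles _ _, hx, le_rfl, Reduces.refl _⟩
    | cons a x =>
      rw [List.forall_mem_cons] at hx
      obtain ⟨v, hv, hvl, hlen, hred⟩ := ih _ (Nat.lt_succ_self _) x hx.2 rfl
      have havl : ∀ b ∈ a :: v, b ∈ letters := List.forall_mem_cons.2 ⟨hx.1, hvl⟩
      have hlen' : (a :: v).length ≤ (a :: x).length := Nat.succ_le_succ hlen
      have hred' := hred.cons a
      by_cases h : reducible (a :: v) = true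
      · obtain ⟨q, hq, t, ht⟩ := exists_rule_of_reducible h
        have hrule := (reduces_of_mem_rules (α := α) hq).append_right t
        rw [ht] at havl hlen' hred'
        have hlt : (q.2 ++ t).length < (a :: x).length := by
          refine lt_of_lt_of_le ?_ hlen'
          rw [List.length_append, List.length_append]
          exact Nat.add_lt_add_right (rules_wellFormed q hq).1 _
        obtain ⟨u, hu, hul, hulen, hured⟩ := ih _ hlt (q.2 ++ t) (List.forall_mem_append.2
          ⟨(rules_wellFormed q hq).2, (List.forall_mem_append.1 havl).2⟩) rfl
        exact ⟨u, hu, hul, hulen.trans hlt.le, hred'.trans (hrule.trans hured)⟩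
      · exact ⟨a :: v, cons_mem_irreducibles hx.1 hv
          (by simpa using irreducibles_check.2 v hv) (by simpa using h), havl, hlen', hred'⟩

/-! ### Counting the orbit -/

/-- Every member of the orbit of `L` compares with `v(L)` or with `v(Lᴿ)` for some irreducible
word `v`. -/
theorem exists_red_applyWord (x : List LangOp) (L : Language α) :
    ∃ v ∈ irreducibles 20 [], ∃ K ∈ ({L, apply r L} : Set (Language α)),
      Red (applyWord x L) (applyWord v K) := by
  suffices h : ∃ v, (∀ a ∈ v, a ∈ letters) ∧ ∃ K ∈ ({L, apply r L} : Set (Language α)),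
      Red (applyWord x L) (applyWord v K) by
    obtain ⟨v, hv, K, hK, hred⟩ := h
    obtain ⟨u, hu, -, -, hvu⟩ := exists_irreducible α v hv
    exact ⟨u, hu, K, hK, hred.trans (hvu K)⟩
  induction x with
  | nil => exact ⟨[], by simp, L, Or.inl rfl, Red.refl _⟩
  | cons a x ih =>
    obtain ⟨v, hv, K, hK, hred⟩ := ih
    have hred' := hred.congr_apply a
    by_cases ha : a ∈ letters
    · exact ⟨a :: v, List.forall_mem_cons.2 ⟨ha, hv⟩, K, hK, hred'⟩
    · obtain rfl | rfl : a = e ∨ a = r := by revert ha; cases a <;> decide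
      · exact ⟨k :: v, List.forall_mem_cons.2 ⟨by decide, hv⟩, K, hK,
          hred'.trans (red_apply_e _)⟩
      · have hmirror : ∀ a ∈ letters, mirror a ∈ letters := by decide
        have hr := apply_r_applyWord v K
        refine ⟨v.map mirror, List.forall_mem_map.2 fun a ha => hmirror a (hv a ha),
          apply r K, ?_, hr ▸ hred'⟩
        rcases hK with rfl | rfl
        · exact Or.inr rfl
        · exact Or.inl (apply_r_r L)

/-- The nonempty words of a language. -/
def core (M : Language α) : Set (List α) := {x | x ∈ M ∧ x ≠ []}

theorem core_eq_or_eq_of_red {M N : Language α} (h : Red M N) :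
    core M ∈ ({∅, {x | x ≠ []}} : Set (Set (List α))) ∨ core M = core N := by
  rcases h with (h | h) | h
  · exact Or.inl (Or.inl (Set.eq_empty_of_forall_notMem fun x hx => hx.2 (h x hx.1)))
  · exact Or.inl (Or.inr (Set.ext fun x => ⟨fun hx => hx.2, fun hx => ⟨h x hx, hx⟩⟩))
  · exact Or.inr (Set.ext fun x => and_congr_left fun hx => h x hx)

/-- A language is determined by its core and by whether it contains the empty word. -/
theorem eq_core_or_eq_insert_core (M : Language α) :
    core M = M ∨ insert [] (core M) = (M : Set (List α)) := by
  by_cases h : [] ∈ M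
  · refine Or.inr (Set.ext fun x => ?_)
    by_cases hx : x = []
    · subst hx
      exact ⟨fun _ => h, fun _ => Or.inl rfl⟩
    · exact ⟨fun h => (h.resolve_left hx).1, fun h => Or.inr ⟨h, hx⟩⟩
  · refine Or.inl (Set.ext fun x => ⟨fun hx => hx.1, fun hx => ⟨hx, ?_⟩⟩)
    rintro rfl
    exact h hx

theorem encard_setOf_mem_le {β : Type*} (l : List β) : {x | x ∈ l}.encard ≤ l.length := by
  classical
  have h : {x | x ∈ l} = (l.toFinset : Set β) := by ext; simp
  rw [h, Set.encard_coe_eq_coe_finsetCard]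
  exact_mod_cast l.toFinset_card_le

/-- The cores of the languages in an orbit: the two trivial ones, and at most one for each
irreducible word and each of `L` and its reversal. -/
theorem encard_core_image_orbit_le (S : Set LangOp) (L : Language α) :
    (core '' orbit S L).encard ≤ 2126 := by
  let V (K : Language α) : Set (Set (List α)) :=
    (fun v => core (applyWord v K)) '' {v | v ∈ irreducibles 20 []}
  have hV : ∀ K, (V K).encard ≤ 1062 := fun K =>
    (Set.encard_image_le _ _).trans <| (encard_setOf_mem_le _).trans <| by
      exact_mod_cast irreducibles_check.1
  have hpair : ({∅, {x | x ≠ []}} : Set (Set (List α))).encard ≤ 2 :=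
    (Set.encard_insert_le _ _).trans (by rw [Set.encard_singleton]; norm_num)
  have hsub : core '' orbit S L ⊆ {∅, {x | x ≠ []}} ∪ (V L ∪ V (apply r L)) := by
    rintro _ ⟨_, ⟨x, -, rfl⟩, rfl⟩
    obtain ⟨v, hv, K, hK, hred⟩ := exists_red_applyWord x L
    refine (core_eq_or_eq_of_red hred).imp_right fun h => ?_
    rcases hK with rfl | rfl
    · exact Or.inl ⟨v, hv, h.symm⟩
    · exact Or.inr ⟨v, hv, h.symm⟩
  calc (core '' orbit S L).encard
      ≤ ({∅, {x | x ≠ []}} : Set (Set (List α))).encard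
          + ((V L).encard + (V (apply r L)).encard) :=
        (Set.encard_le_encard hsub).trans <| (Set.encard_union_le _ _).trans <|
          add_le_add_right (Set.encard_union_le _ _) _
    _ ≤ 2 + (1062 + 1062) := add_le_add hpair (add_le_add (hV _) (hV _))
    _ = 2126 := by norm_num

theorem encard_orbit_le (S : Set LangOp) (L : Language α) : (orbit S L).encard ≤ 4252 := by
  have hsub : orbit S L ⊆ core '' orbit S L ∪ insert [] '' (core '' orbit S L) := by
    intro M hM
    exact (eq_core_or_eq_insert_core M).imp (fun h => ⟨M, hM, h⟩)
      fun h => ⟨_, ⟨M, hM, rfl⟩, h⟩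
  calc (orbit S L).encard
      ≤ (core '' orbit S L).encard + (insert [] '' (core '' orbit S L)).encard :=
        (Set.encard_le_encard hsub).trans (Set.encard_union_le _ _)
    _ ≤ 2126 + 2126 := add_le_add (encard_core_image_orbit_le S L)
        ((Set.encard_image_le _ _).trans (encard_core_image_orbit_le S L))
    _ = 4252 := by norm_num

end LangOp

theorem mainTheorem1 {α : Type*} [Finite α] (L : Language α) :
    (LangOp.orbit {LangOp.k, LangOp.e, LangOp.c, LangOp.p,
      LangOp.f, LangOp.s, LangOp.w, LangOp.r} L).encard ≤ 5676 :=
  (LangOp.encard_orbit_le _ L).trans (by norm_num)
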